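/- Let $H_0^-=0$ and $H_n^-=\sum_{k=1}^n \frac{(-1)^{k-1}}{k}$ for $n\ge 1$, and let $\mathrm{Li}_m(z)=\sum_{n\ge1} z^n/n^m$ for $|z|\le 1$, $m=2,3$. For complex $x$ with $|x|\le 1$, $x\ne 1$, put $$\begin{aligned}F(x)={}&\int_0^x\frac{\mathrm{Li}_2(t)}{1-t}\,dt+\log(1-x)\Big[2\,\mathrm{Li}_2\Big(\frac{1+x}2\Big)-\frac{\pi^2}6\Big]+2\log(1+x)\big(\log^2(1-x)-\log^2 2\big)\\&+2\log2\Big[\mathrm{Li}_2\Big(\frac{1+x}2\Big)-\mathrm{Li}_2\Big(\frac12\Big)\Big]-2\log2\,\log^2(1-x)\\&+4\log(1-x)\,\mathrm{Li}_2\Big(\frac{1-x}2\Big)-4\Big[\mathrm{Li}_3\Big(\frac{1-x}2\Big)-\mathrm{Li}_3\Big(\frac12\Big)\Big],\end{aligned}$$ where the logarithms are principal, the integral is taken along the segment from $0$ to $x$, and at $x=-1$ the term $2\log(1+x)(\log^2(1-x)-\log^2 2)$ is read as its limit $0$. Then for all complex $x$ with $|x|\le 1$, $x\neq 1$, the integral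 exists and $$\sum_{n=0}^\infty (H_n^--\log 2)^2\,\frac{x^{n+1}}{n+1}=F(x).$$ In particular, at $x=\pm1$, where the closed form is read as the limit of $F$ within the closed unit disk, $$\sum_{n=0}^\infty \frac{(H_n^--\log 2)^2}{n+1}=\lim_{x\to 1}F(x)=\tfrac32\zeta(3)-\tfrac{\pi^2}6\log 2-\tfrac13\log^3 2,$$ $$\sum_{n=0}^\infty (H_n^--\log 2)^2\frac{(-1)^{n+1}}{n+1}=\lim_{x\to -1}F(x)=\tfrac{\pi^2}{12}\log 2-\tfrac34\zeta(3)-\tfrac13\log^3 2.$$ All the series converge absolutely. -/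

import Mathlib

open Filter Topology MeasureTheory

noncomputable section

/-- The skew-harmonic number `1 - 1/2 + ... + (-1)^(n-1)/n`; it is `0` for `n = 0`. -/
def skewHarmonic (n : ℕ) : ℝ :=
  ∑ k ∈ Finset.range n, (-1 : ℝ) ^ k / ((k : ℝ) + 1)

/-- The polylogarithm `Li_m(z) = ∑_{n ≥ 1} z^n / n^m`, used for `m = 2, 3` and `‖z‖ ≤ 1`, where
the series converges absolutely. -/
def polyLog (m : ℕ) (z : ℂ) : ℂ :=
  ∑' n : ℕ, z ^ (n + 1) / ((n : ℂ) + 1) ^ m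

/-- The integral of `f` along the straight segment from `0` to `x`, by the parametrization
`t = s x` with `0 ≤ s ≤ 1`. For real `x` it is the ordinary integral of `f` from `0` to `x`. -/
def segmentIntegral (f : ℂ → ℂ) (x : ℂ) : ℂ :=
  ∫ s in (0 : ℝ)..1, x * f ((s : ℂ) * x)

/-- The function `Li_2(t) / (1 - t)`. -/
def dilogKernel (t : ℂ) : ℂ :=
  polyLog 2 t / (1 - t)

/-- The `n`-th term `(H_n^- - log 2)^2 x^(n+1) / (n+1)` of the series. -/
def skewTerm (x : ℂ) (n : ℕ) : ℂ :=
  ((skewHarmonic n : ℂ) - Complex.log 2) ^ 2 * (x ^ (n + 1) / ((n : ℂ) + 1))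

/-- The closed form. All logarithms are principal. -/
def skewClosedForm (x : ℂ) : ℂ :=
  segmentIntegral dilogKernel x
    + Complex.log (1 - x) * (2 * polyLog 2 ((1 + x) / 2) - (Real.pi : ℂ) ^ 2 / 6)
    + 2 * Complex.log (1 + x) * (Complex.log (1 - x) ^ 2 - Complex.log 2 ^ 2)
    + 2 * Complex.log 2 * (polyLog 2 ((1 + x) / 2) - polyLog 2 (1 / 2))
    - 2 * Complex.log 2 * Complex.log (1 - x) ^ 2
    + 4 * Complex.log (1 - x) * polyLog 2 ((1 - x) / 2)
    - 4 * (polyLog 3 ((1 - x) / 2) - polyLog 3 (1 / 2))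

end

/-! Write `a n` for `skewTail n`. As the tail of an alternating series it is at most `1/(n+1)` in
modulus, so the terms are bounded by `1/(n+1)^2` uniformly on the closed disk and the sum is
continuous there. Inside the disk, multiply the derivative `∑ (a n)^2 x^n` by `1 - x` and sum by
parts. The differences of `(a n)^2` involve `a (n+1) (-1)^n / (n+1)` and `1/(n+1)^2`, and a second
summation by parts handles the former. The outcome, `one_sub_mul_tsum_skewTail_sq`, is `Li_2(x) +
π²/6 - 2 Li_2((1+x)/2)`. Division by `1 - x` gives the integrand `Li_2(t)/(1-t)` plus the derivative
of `skewElementary`; integrating along the segment from `0` to `x` proves the closed form, boundary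
points included, by continuity. At `x = ±1` the integral is expressed through `Li_3`, using
reflection, Landen's identities and `Li_3(1/2)`. The limits of the closed form are then inherited
from the continuity of the series. -/

noncomputable section

/-! ### Calculus of power series in the open disk -/

/-- A function on a segment, continuous up to the ends, with vanishing derivative inside,
takes the same value at both ends. -/
lemma eq_of_hasDerivAt_zero {f : ℝ → ℂ} {a b : ℝ} (hab : a ≤ b)
    (hc : ContinuousOn f (Set.Icc a b)) (hd : ∀ x ∈ Set.Ioo a b, HasDerivAt f 0 x) :
    f a = f b := by
  have h := intervalIntegral.integral_eq_sub_of_hasDerivAt_of_le hab hc (f' := fun _ => 0) hd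
    (by simp)
  simp only [intervalIntegral.integral_zero] at h
  exact (sub_eq_zero.mp h.symm).symm

lemma summable_mul_pow_of_bounded {c : ℕ → ℂ} {C : ℝ} (hc : ∀ n, ‖c n‖ ≤ C) {x : ℂ}
    (hx : ‖x‖ < 1) : Summable fun n => c n * x ^ n := by
  refine Summable.of_norm_bounded
    ((summable_geometric_of_lt_one (norm_nonneg x) hx).mul_left C) fun n => ?_
  rw [norm_mul, norm_pow]
  gcongr
  exact hc n

lemma hasDerivAt_tsum_pow {c : ℕ → ℂ} {C : ℝ} (hc : ∀ n, ‖c n‖ ≤ C) {x : ℂ} (hx : ‖x‖ < 1) :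
    HasDerivAt (fun z => ∑' n, c n * (z ^ (n + 1) / ((n : ℂ) + 1))) (∑' n, c n * x ^ n) x := by
  obtain ⟨r, hxr, hr⟩ := exists_between hx
  have hr0 : 0 < r := (norm_nonneg x).trans_lt hxr
  refine hasDerivAt_tsum_of_isPreconnected (u := fun n => C * r ^ n)
    (g := fun n z => c n * (z ^ (n + 1) / ((n : ℂ) + 1))) (g' := fun n z => c n * z ^ n) (t := Metric.ball 0 r)
    (y₀ := (0 : ℂ)) ((summable_geometric_of_lt_one hr0.le hr).mul_left C) Metric.isOpen_ball
    (convex_ball _ _).isPreconnected (fun n y _ => ?_) (fun n y hy => ?_)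
    (Metric.mem_ball_self hr0) ?_ (mem_ball_zero_iff.mpr hxr)
  · have h := ((hasDerivAt_pow (n + 1) y).div_const ((n : ℂ) + 1)).const_mul (c n)
    refine h.congr_deriv ?_
    have : (n : ℂ) + 1 ≠ 0 := by exact_mod_cast n.succ_ne_zero
    rw [Nat.cast_add_one, Nat.add_sub_cancel]
    field_simp
  · rw [norm_mul, norm_pow]
    have : ‖y‖ ≤ r := by simpa using (Metric.mem_ball.mp hy).le
    have : 0 ≤ C := (norm_nonneg _).trans (hc 0)
    gcongr
    exact hc n
  · simp [summable_zero]

/-- Summation by parts. It is applied to the squared tails at `x`, and to the shifted tails at `-x`,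
where the alternating sign is absorbed. -/
lemma one_sub_mul_tsum {c : ℕ → ℂ} {C : ℝ} (hc : ∀ n, ‖c n‖ ≤ C) {x : ℂ} (hx : ‖x‖ < 1) :
    (1 - x) * ∑' n, c n * x ^ n = c 0 + ∑' n, (c (n + 1) - c n) * x ^ (n + 1) := by
  have hs := summable_mul_pow_of_bounded hc hx
  have h1 := hs.tsum_eq_zero_add
  have h2 : Summable fun n => c (n + 1) * x ^ (n + 1) := (summable_nat_add_iff 1).mpr hs
  have h3 : ∑' n, (c (n + 1) - c n) * x ^ (n + 1)
      = ∑' n, c (n + 1) * x ^ (n + 1) - x * ∑' n, c n * x ^ n := by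
    rw [← tsum_mul_left, ← h2.tsum_sub (hs.mul_left x)]
    congr 1
    ext n
    ring
  rw [h3, sub_mul, one_mul]
  conv_lhs => rw [h1]
  rw [h1]
  simp
  ring

/-! ### Polylogarithms: derivatives, continuity, values at `±1` -/

lemma norm_inv_natCast_add_one_pow_le (m n : ℕ) : ‖(((n : ℂ) + 1) ^ m)⁻¹‖ ≤ 1 := by
  rw [norm_inv, norm_pow]
  have : ‖(n : ℂ) + 1‖ = n + 1 := by
    rw [← Nat.cast_add_one, Complex.norm_natCast]; push_cast; rfl
  rw [this]
  exact inv_le_one_of_one_le₀ (one_le_pow₀ (by linarith [n.cast_nonneg (α := ℝ)]))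

/-- `polyLog m z / z`, extended analytically to `z = 0`. -/
def polyLogQuot (m : ℕ) (z : ℂ) : ℂ :=
  ∑' n : ℕ, (((n : ℂ) + 1) ^ m)⁻¹ * z ^ n

lemma mul_polyLogQuot (m : ℕ) (z : ℂ) : z * polyLogQuot m z = polyLog m z := by
  rw [polyLogQuot, polyLog, ← tsum_mul_left]
  congr 1
  ext n
  ring

lemma polyLogQuot_eq {m : ℕ} {z : ℂ} (hz : z ≠ 0) : polyLogQuot m z = polyLog m z / z := by
  rw [← mul_polyLogQuot, mul_div_cancel_left₀ _ hz]

lemma polyLog_one_left {z : ℂ} (hz : ‖z‖ < 1) : polyLog 1 z = -Complex.log (1 - z) := by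
  rw [← (Complex.hasSum_taylorSeries_neg_log hz).tsum_eq,
    (Complex.hasSum_taylorSeries_neg_log hz).summable.tsum_eq_zero_add]
  simp [polyLog]

lemma hasDerivAt_polyLog (m : ℕ) {z : ℂ} (hz : ‖z‖ < 1) :
    HasDerivAt (polyLog (m + 1)) (polyLogQuot m z) z := by
  have h := hasDerivAt_tsum_pow (norm_inv_natCast_add_one_pow_le m) hz
  refine h.congr_of_eventuallyEq (Eventually.of_forall fun w => ?_)
  rw [polyLog]
  congr 1
  ext n
  rw [pow_succ _ m, mul_comm (_ ^ m), ← div_div, ← div_eq_inv_mul]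

lemma hasDerivAt_polyLog_two {z : ℂ} (hz : ‖z‖ < 1) (h0 : z ≠ 0) :
    HasDerivAt (polyLog 2) (-Complex.log (1 - z) / z) z := by
  rw [← polyLog_one_left hz, ← polyLogQuot_eq h0]
  exact hasDerivAt_polyLog 1 hz

lemma hasDerivAt_polyLog_three {z : ℂ} (hz : ‖z‖ < 1) (h0 : z ≠ 0) :
    HasDerivAt (polyLog 3) (polyLog 2 z / z) z := by
  rw [← polyLogQuot_eq h0]
  exact hasDerivAt_polyLog 2 hz

lemma norm_polyLog_term_le {m : ℕ} (hm : 2 ≤ m) {z : ℂ} (hz : ‖z‖ ≤ 1) (n : ℕ) :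
    ‖z ^ (n + 1) / ((n : ℂ) + 1) ^ m‖ ≤ 1 / ((n : ℝ) + 1) ^ 2 := by
  have h1 : ‖(n : ℂ) + 1‖ = n + 1 := by
    rw [← Nat.cast_add_one, Complex.norm_natCast]; push_cast; rfl
  rw [norm_div, norm_pow, norm_pow, h1]
  have h2 : (1 : ℝ) ≤ n + 1 := by linarith [n.cast_nonneg (α := ℝ)]
  have h3 := pow_le_pow_right₀ h2 hm
  have h4 : ‖z‖ ^ (n + 1) ≤ 1 := pow_le_one₀ (norm_nonneg _) hz
  gcongr

lemma summable_one_div_natCast_add_one_sq : Summable fun n : ℕ => 1 / ((n : ℝ) + 1) ^ 2 := by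
  have := (summable_nat_add_iff 1).mpr (Real.summable_one_div_nat_pow.mpr (le_refl 2))
  simpa using this

lemma summable_polyLog {m : ℕ} (hm : 2 ≤ m) {z : ℂ} (hz : ‖z‖ ≤ 1) :
    Summable fun n : ℕ => z ^ (n + 1) / ((n : ℂ) + 1) ^ m :=
  Summable.of_norm_bounded summable_one_div_natCast_add_one_sq (norm_polyLog_term_le hm hz)

lemma continuousOn_polyLog {m : ℕ} (hm : 2 ≤ m) :
    ContinuousOn (polyLog m) (Metric.closedBall 0 1) :=
  continuousOn_tsum (fun n => by fun_prop) summable_one_div_natCast_add_one_sq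
    fun n z hz => norm_polyLog_term_le hm (by simpa using hz) n

lemma polyLog_zero_right (m : ℕ) : polyLog m 0 = 0 := by simp [polyLog]

lemma polyLog_two_one : polyLog 2 1 = (Real.pi : ℂ) ^ 2 / 6 := by
  have h := hasSum_zeta_two
  rw [hasSum_nat_add_iff' (f := fun n : ℕ => (1 : ℝ) / (n : ℝ) ^ 2) 1 |>.symm] at h
  have h2 := (Complex.hasSum_ofReal.mpr h).tsum_eq
  simp at h2
  simp [polyLog, h2]

lemma polyLog_three_one : polyLog 3 1 = riemannZeta 3 := by
  have h := zeta_eq_tsum_one_div_nat_add_one_cpow (s := 3) (by norm_num)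
  rw [h, polyLog]
  congr 1
  ext n
  rw [one_pow]
  norm_cast

lemma tsum_eq_tsum_odd {f : ℕ → ℂ} (hf : Summable f) (h : ∀ k, f (2 * k) = 0) :
    ∑' n, f n = ∑' k, f (2 * k + 1) := by
  have h1 := hf.comp_injective (i := fun k => 2 * k) (mul_right_injective₀ two_ne_zero)
  have h2 := hf.comp_injective (i := fun k => 2 * k + 1)
    ((add_left_injective 1).comp (mul_right_injective₀ two_ne_zero))
  rw [← tsum_even_add_odd h1 h2]
  simp [h]

/-- Odd powers of `z` cancel. The exponent is `n + 1`, so the surviving indices `n` are the odd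
ones. -/
lemma polyLog_add_polyLog_neg {m : ℕ} (hm : 2 ≤ m) {z : ℂ} (hz : ‖z‖ ≤ 1) :
    polyLog m z + polyLog m (-z) = 2 / 2 ^ m * polyLog m (z ^ 2) := by
  have h1 := summable_polyLog hm hz
  have h2 := summable_polyLog (z := -z) hm (by simpa using hz)
  rw [polyLog, polyLog, ← h1.tsum_add h2, tsum_eq_tsum_odd (h1.add h2), polyLog, ← tsum_mul_left]
  · congr 1
    ext k
    have h3 : ((2 * k + 1 : ℕ) : ℂ) + 1 = 2 * (k + 1) := by push_cast; ring
    have h4 : (-z) ^ (2 * k + 1 + 1) = z ^ (2 * k + 1 + 1) :=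
      Even.neg_pow ⟨k + 1, by ring⟩ z
    rw [h3, h4, mul_pow, ← pow_mul, ← add_div, show 2 * (k + 1) = 2 * k + 1 + 1 by ring,
      div_mul_div_comm, two_mul (z ^ _)]
  · intro k
    rw [Odd.neg_pow ⟨k, rfl⟩ z, neg_div, add_neg_cancel]

lemma polyLog_three_neg_one : polyLog 3 (-1) = -3 / 4 * riemannZeta 3 := by
  have h := polyLog_add_polyLog_neg (m := 3) (by norm_num) (z := 1) (by simp)
  rw [one_pow, polyLog_three_one] at h
  linear_combination h

/-! ### Functional equations on real intervals and values at `1/2` -/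

/-- The logarithmic singularity at `0` is cancelled by a zero of a differentiable function. -/
lemma continuousWithinAt_log_mul {h : ℝ → ℂ} (hd : DifferentiableAt ℝ h 0) (h0 : h 0 = 0) :
    ContinuousWithinAt (fun y : ℝ => Complex.log y * h y) (Set.Ici 0) 0 := by
  -- As `h 0 = 0`, `h y` is `y` times its slope from `0`, and `y log y` is continuous at `0`.
  have h1 : ContinuousAt (fun y : ℝ => ((y * Real.log y : ℝ) : ℂ) * dslope h 0 y) 0 :=
    (Complex.continuous_ofReal.comp Real.continuous_mul_log).continuousAt.mul
      (continuousAt_dslope_same.mpr hd)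
  have h2 : ∀ y : ℝ, 0 ≤ y →
      Complex.log y * h y = ((y * Real.log y : ℝ) : ℂ) * dslope h 0 y := by
    intro y hy
    have h3 := sub_smul_dslope h 0 y
    rw [h0, sub_zero, sub_zero, Complex.real_smul] at h3
    rw [← h3, ← Complex.ofReal_log hy]
    push_cast
    ring
  exact h1.continuousWithinAt.congr (fun y hy => h2 y hy) (h2 0 le_rfl)

lemma norm_ofReal_lt_one {r : ℝ} (h1 : -1 < r) (h2 : r < 1) : ‖(r : ℂ)‖ < 1 := by
  rw [Complex.norm_real, Real.norm_eq_abs, abs_lt]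
  exact ⟨h1, h2⟩

lemma norm_ofReal_le_one {r : ℝ} (h1 : -1 ≤ r) (h2 : r ≤ 1) : ‖(r : ℂ)‖ ≤ 1 := by
  rw [Complex.norm_real, Real.norm_eq_abs, abs_le]
  exact ⟨h1, h2⟩

lemma continuousOn_polyLog_comp {X : Type*} [TopologicalSpace X] {m : ℕ} (hm : 2 ≤ m) {f : X → ℂ}
    {s : Set X} (hf : ContinuousOn f s) (hs : ∀ x ∈ s, ‖f x‖ ≤ 1) :
    ContinuousOn (fun x => polyLog m (f x)) s :=
  (continuousOn_polyLog hm).comp hf fun x hx => by simpa using hs x hx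

lemma continuousAt_clog_ofReal {t : ℝ} (ht : 0 < t) :
    ContinuousAt (fun t : ℝ => Complex.log (t : ℂ)) t :=
  ContinuousAt.clog Complex.continuous_ofReal.continuousAt (Complex.ofReal_mem_slitPlane.mpr ht)

lemma ofReal_one_sub_mem_slitPlane {t : ℝ} (ht : t < 1) : 1 - (t : ℂ) ∈ Complex.slitPlane := by
  rw [← Complex.ofReal_one, ← Complex.ofReal_sub]
  exact Complex.ofReal_mem_slitPlane.mpr (by linarith)

lemma continuousAt_clog_one_sub {t : ℝ} (ht : t < 1) :
    ContinuousAt (fun t : ℝ => Complex.log (1 - (t : ℂ))) t :=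
  ContinuousAt.clog (by fun_prop) (ofReal_one_sub_mem_slitPlane ht)

lemma hasDerivAt_polyLog_two_one_sub {z : ℂ} (hz : ‖1 - z‖ < 1) (h1 : z ≠ 1) :
    HasDerivAt (fun z => polyLog 2 (1 - z)) (Complex.log z / (1 - z)) z := by
  have h := (hasDerivAt_polyLog_two hz (sub_ne_zero.mpr h1.symm)).comp z
    ((hasDerivAt_id z).const_sub 1)
  refine h.congr_deriv ?_
  rw [sub_sub_cancel]
  ring

lemma hasDerivAt_clog_one_sub {z : ℂ} (hz : 1 - z ∈ Complex.slitPlane) :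
    HasDerivAt (fun z => Complex.log (1 - z)) (-1 / (1 - z)) z :=
  ((hasDerivAt_id z).const_sub 1).clog hz

/-- Euler's reflection formula for the dilogarithm on the unit interval. -/
lemma polyLog_two_reflection {t : ℝ} (h0 : 0 ≤ t) (h1 : t ≤ 1) :
    polyLog 2 t + polyLog 2 (1 - t)
      = (Real.pi : ℂ) ^ 2 / 6 - Complex.log t * Complex.log (1 - t) := by
  rcases h1.eq_or_lt with rfl | h1
  · simp [polyLog_zero_right, polyLog_two_one]
  -- The constant is read off at `0`, where the product of logarithms tends to `0`. The case `t = 1`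
  -- was split off because `log (1 - t)` is singular there.
  have key := eq_of_hasDerivAt_zero (f := fun t : ℝ =>
      polyLog 2 (t : ℂ) + polyLog 2 (1 - (t : ℂ)) + Complex.log t * Complex.log (1 - (t : ℂ)))
    h0 ?_ ?_
  · simp only [Complex.ofReal_zero, sub_zero, Complex.log_one, polyLog_zero_right,
      polyLog_two_one] at key
    linear_combination -key
  · refine ((continuousOn_polyLog_comp le_rfl (by fun_prop) ?_).add
      (continuousOn_polyLog_comp le_rfl (by fun_prop) ?_)).add ?_
    · intro x hx
      exact norm_ofReal_le_one (by linarith [hx.1]) (by linarith [hx.2])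
    · intro x hx
      rw [← Complex.ofReal_one, ← Complex.ofReal_sub]
      exact norm_ofReal_le_one (by linarith [hx.2]) (by linarith [hx.1])
    · intro x hx
      rcases hx.1.eq_or_lt with rfl | hx0
      · refine (continuousWithinAt_log_mul ?_ (by simp)).mono fun y hy => hy.1
        exact (hasDerivAt_clog_one_sub (z := ((0 : ℝ) : ℂ))
          (by simp)).comp_ofReal.differentiableAt
      · exact ((continuousAt_clog_ofReal hx0).mul
          (continuousAt_clog_one_sub (hx.2.trans_lt h1))).continuousWithinAt
  · intro x hx
    have hx1 : x < 1 := hx.2.trans h1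
    have a1 := hasDerivAt_polyLog_two (z := x) (norm_ofReal_lt_one (by linarith [hx.1]) hx1)
      (by exact_mod_cast hx.1.ne')
    have a2 := hasDerivAt_polyLog_two_one_sub (z := x) (by
      rw [← Complex.ofReal_one, ← Complex.ofReal_sub]
      exact norm_ofReal_lt_one (by linarith) (by linarith [hx.1])) (by exact_mod_cast hx1.ne)
    have a3 := (Complex.hasDerivAt_log (Complex.ofReal_mem_slitPlane.mpr hx.1)).mul
      (hasDerivAt_clog_one_sub (ofReal_one_sub_mem_slitPlane hx1))
    refine ((a1.add a2).add a3).comp_ofReal.congr_deriv ?_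
    ring

lemma polyLog_two_half :
    polyLog 2 (1 / 2) = (Real.pi : ℂ) ^ 2 / 12 - Complex.log 2 ^ 2 / 2 := by
  have h := polyLog_two_reflection (t := 1 / 2) (by norm_num) (by norm_num)
  have h2 : Complex.log (1 / 2) = -Complex.log 2 := by
    rw [one_div, Complex.log_inv]
    rw [← Complex.ofReal_ofNat, Complex.arg_ofReal_of_nonneg (by norm_num)]
    exact Real.pi_ne_zero.symm
  push_cast at h
  rw [show (1 : ℂ) - 1 / 2 = 1 / 2 by norm_num, h2] at h
  linear_combination h / 2

lemma clog_inv_ofReal {t : ℝ} (ht : 0 < t) : Complex.log (t : ℂ)⁻¹ = -Complex.log t := by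
  rw [Complex.log_inv]
  rw [Complex.arg_ofReal_of_nonneg ht.le]
  exact Real.pi_ne_zero.symm

/-- The bound `1/2 ≤ t` is exactly `-1 ≤ 1 - 1/t`; it fixes the range of both Landen identities. -/
lemma norm_one_sub_inv_le_one {t : ℝ} (h0 : 1 / 2 ≤ t) (h1 : t ≤ 1) : ‖1 - (t : ℂ)⁻¹‖ ≤ 1 := by
  rw [← Complex.ofReal_one, ← Complex.ofReal_inv, ← Complex.ofReal_sub]
  have h2 : t⁻¹ ≤ 2 := by rw [inv_le_comm₀ (by linarith) (by norm_num)]; linarith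
  have h3 : 1 ≤ t⁻¹ := (one_le_inv₀ (by linarith)).mpr h1
  exact norm_ofReal_le_one (by linarith) (by linarith)

lemma norm_one_sub_inv_lt_one {t : ℝ} (h0 : 1 / 2 < t) (h1 : t < 1) : ‖1 - (t : ℂ)⁻¹‖ < 1 := by
  rw [← Complex.ofReal_one, ← Complex.ofReal_inv, ← Complex.ofReal_sub]
  have h2 : t⁻¹ < 2 := by rw [inv_lt_comm₀ (by linarith) (by norm_num)]; linarith
  have h3 : 1 ≤ t⁻¹ := (one_le_inv₀ (by linarith)).mpr h1.le
  exact norm_ofReal_lt_one (by linarith) (by linarith)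

lemma hasDerivAt_one_sub_inv {z : ℂ} (hz : z ≠ 0) :
    HasDerivAt (fun z : ℂ => 1 - z⁻¹) (1 / z ^ 2) z :=
  ((hasDerivAt_inv hz).const_sub 1).congr_deriv (by rw [neg_neg, one_div])

lemma one_sub_inv_ne_zero {t : ℝ} (h1 : t < 1) : 1 - (t : ℂ)⁻¹ ≠ 0 := by
  rw [sub_ne_zero]
  intro h
  have h2 : (t : ℂ) = 1 := by rw [← inv_inv (t : ℂ), ← h, inv_one]
  exact h1.ne (by exact_mod_cast h2)

/-- Landen's identity for the dilogarithm. -/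
lemma polyLog_two_landen {t : ℝ} (h0 : 1 / 2 ≤ t) (h1 : t ≤ 1) :
    polyLog 2 (1 - t) + polyLog 2 (1 - (t : ℂ)⁻¹) = -Complex.log t ^ 2 / 2 := by
  have key := eq_of_hasDerivAt_zero (f := fun t : ℝ =>
      polyLog 2 (1 - (t : ℂ)) + polyLog 2 (1 - (t : ℂ)⁻¹) + Complex.log t ^ 2 / 2) h1 ?_ ?_
  · simp only [Complex.ofReal_one, inv_one, sub_self, Complex.log_one, polyLog_zero_right] at key
    linear_combination key
  · refine ((continuousOn_polyLog_comp le_rfl (by fun_prop) ?_).add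
      (continuousOn_polyLog_comp le_rfl ?_ ?_)).add ?_
    · intro x hx
      rw [← Complex.ofReal_one, ← Complex.ofReal_sub]
      exact norm_ofReal_le_one (by linarith [hx.2]) (by linarith [hx.1])
    · refine continuousOn_const.sub (Complex.continuous_ofReal.continuousOn.inv₀ fun x hx => ?_)
      have : x ≠ 0 := by linarith [hx.1]
      exact_mod_cast this
    · intro x hx
      exact norm_one_sub_inv_le_one (h0.trans hx.1) hx.2
    · intro x hx
      exact (((continuousAt_clog_ofReal (by linarith [hx.1])).pow 2).div_const 2).continuousWithinAt
  · intro x hx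
    have hx0 : 1 / 2 < x := h0.trans_lt hx.1
    have hxp : 0 < x := by linarith
    have hxc : (x : ℂ) ≠ 0 := by exact_mod_cast hxp.ne'
    have hx1 : 1 - (x : ℂ) ≠ 0 := sub_ne_zero.mpr (by exact_mod_cast hx.2.ne')
    have a1 := hasDerivAt_polyLog_two_one_sub (z := x) (by
      rw [← Complex.ofReal_one, ← Complex.ofReal_sub]
      exact norm_ofReal_lt_one (by linarith [hx.2]) (by linarith)) (by exact_mod_cast hx.2.ne)
    have a2 := (hasDerivAt_polyLog_two (norm_one_sub_inv_lt_one hx0 hx.2)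
      (one_sub_inv_ne_zero hx.2)).comp (x : ℂ) (hasDerivAt_one_sub_inv hxc)
    have a3 := ((Complex.hasDerivAt_log (Complex.ofReal_mem_slitPlane.mpr hxp)).pow 2).div_const 2
    refine ((a1.add a2).add a3).comp_ofReal.congr_deriv ?_
    rw [sub_sub_cancel, clog_inv_ofReal hxp]
    have h5 : 1 - (x : ℂ)⁻¹ = -(1 - x) / x := by field_simp; ring
    rw [h5]
    field_simp
    ring

/-- Landen's identity for the trilogarithm. -/
lemma polyLog_three_landen {t : ℝ} (h0 : 1 / 2 ≤ t) (h1 : t ≤ 1) :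
    polyLog 3 t + polyLog 3 (1 - t) + polyLog 3 (1 - (t : ℂ)⁻¹)
      = riemannZeta 3 + Complex.log t ^ 3 / 6 + (Real.pi : ℂ) ^ 2 / 6 * Complex.log t
        - Complex.log (1 - t) * Complex.log t ^ 2 / 2 := by
  have key := eq_of_hasDerivAt_zero (f := fun t : ℝ =>
      polyLog 3 (t : ℂ) + polyLog 3 (1 - (t : ℂ)) + polyLog 3 (1 - (t : ℂ)⁻¹)
        - (Complex.log t ^ 3 / 6 + (Real.pi : ℂ) ^ 2 / 6 * Complex.log t)
        + Complex.log (1 - t) * Complex.log t ^ 2 / 2) h1 ?_ ?_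
  · simp only [Complex.ofReal_one, inv_one, sub_self, Complex.log_one, polyLog_zero_right,
      polyLog_three_one] at key
    linear_combination key
  · refine ((((continuousOn_polyLog_comp (by norm_num) (by fun_prop) ?_).add
      (continuousOn_polyLog_comp (by norm_num) (by fun_prop) ?_)).add
      (continuousOn_polyLog_comp (by norm_num) ?_ ?_)).sub ?_).add (ContinuousOn.div_const ?_ 2)
    · intro x hx
      exact norm_ofReal_le_one (by linarith [hx.1]) (by linarith [hx.2])
    · intro x hx
      rw [← Complex.ofReal_one, ← Complex.ofReal_sub]
      exact norm_ofReal_le_one (by linarith [hx.2]) (by linarith [hx.1])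
    · refine continuousOn_const.sub (Complex.continuous_ofReal.continuousOn.inv₀ fun x hx => ?_)
      have : x ≠ 0 := by linarith [hx.1]
      exact_mod_cast this
    · intro x hx
      exact norm_one_sub_inv_le_one (h0.trans hx.1) hx.2
    · intro x hx
      have := continuousAt_clog_ofReal (t := x) (by linarith [hx.1])
      exact (((this.pow 3).div_const 6).add (this.const_mul _)).continuousWithinAt
    · intro x hx
      rcases hx.2.eq_or_lt with rfl | hx1
      -- With `y = 1 - x` the product is `log y * log (1 - y)^2`, whose second factor vanishes at `y
      -- = 0`.
      · have h2 : DifferentiableAt ℝ (fun y : ℝ => Complex.log (1 - (y : ℂ)) ^ 2) 0 :=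
          ((hasDerivAt_clog_one_sub (z := ((0 : ℝ) : ℂ))
            (by simp)).pow 2).comp_ofReal.differentiableAt
        have h3 := continuousWithinAt_log_mul h2 (by simp)
        have h4 : ContinuousWithinAt (fun x : ℝ => 1 - x) (Set.Icc t 1) 1 := by fun_prop
        have h5 := ContinuousWithinAt.comp (t := Set.Ici (0 : ℝ)) (x := (1 : ℝ))
          (by rw [sub_self]; exact h3) h4 (fun x hx => sub_nonneg.mpr hx.2)
        refine h5.congr (fun y _ => ?_) ?_ <;> simp
      · exact ((continuousAt_clog_one_sub hx1).mul
          ((continuousAt_clog_ofReal (by linarith [hx.1])).pow 2)).continuousWithinAt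
  · intro x hx
    have hx0 : 1 / 2 < x := h0.trans_lt hx.1
    have hxp : 0 < x := by linarith
    have hxc : (x : ℂ) ≠ 0 := by exact_mod_cast hxp.ne'
    have hx1 : 1 - (x : ℂ) ≠ 0 := sub_ne_zero.mpr (by exact_mod_cast hx.2.ne')
    have a0 := hasDerivAt_polyLog_three (z := x) (norm_ofReal_lt_one (by linarith) hx.2) hxc
    have a1 := (hasDerivAt_polyLog_three (z := 1 - x) (by
      rw [← Complex.ofReal_one, ← Complex.ofReal_sub]
      exact norm_ofReal_lt_one (by linarith [hx.2]) (by linarith)) hx1).comp (x : ℂ)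
        ((hasDerivAt_id _).const_sub 1)
    have a2 := (hasDerivAt_polyLog_three (norm_one_sub_inv_lt_one hx0 hx.2)
      (one_sub_inv_ne_zero hx.2)).comp (x : ℂ) (hasDerivAt_one_sub_inv hxc)
    have a3 := Complex.hasDerivAt_log (Complex.ofReal_mem_slitPlane.mpr hxp)
    have a4 := hasDerivAt_clog_one_sub (ofReal_one_sub_mem_slitPlane hx.2)
    refine ((((a0.add a1).add a2).sub (((a3.pow 3).div_const 6).add
      (a3.const_mul ((Real.pi : ℂ) ^ 2 / 6)))).add
      ((a4.mul (a3.pow 2)).div_const 2)).comp_ofReal.congr_deriv ?_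
    -- Reflection and the dilogarithmic Landen identity express every dilogarithm in the derivative
    -- through `Li_2(x)`, after which all terms cancel.
    have r1 : polyLog 2 (1 - x) = (Real.pi : ℂ) ^ 2 / 6 - Complex.log x * Complex.log (1 - x)
        - polyLog 2 x :=
      eq_sub_of_add_eq' (polyLog_two_reflection hxp.le hx.2.le)
    have r2 : polyLog 2 (1 - (x : ℂ)⁻¹) = -Complex.log x ^ 2 / 2 - polyLog 2 (1 - x) :=
      eq_sub_of_add_eq' (polyLog_two_landen hx0.le hx.2.le)
    rw [r2, r1]
    have h5 : 1 - (x : ℂ)⁻¹ = -(1 - x) / x := by field_simp; ring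
    rw [h5]
    simp only [Pi.pow_apply]
    field_simp
    ring

lemma clog_half : Complex.log (1 / 2) = -Complex.log 2 := by
  simpa using clog_inv_ofReal (t := 2) (by norm_num)

/-- At `t = 1/2` the arguments `t` and `1 - t` coincide and `1 - 1/t = -1`, so Landen's identity
determines the value. -/
lemma polyLog_three_half :
    polyLog 3 (1 / 2) = 7 / 8 * riemannZeta 3 + Complex.log 2 ^ 3 / 6
      - (Real.pi : ℂ) ^ 2 / 12 * Complex.log 2 := by
  have h := polyLog_three_landen (t := 1 / 2) le_rfl (by norm_num)
  push_cast at h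
  rw [show (1 : ℂ) - (1 / 2)⁻¹ = -1 by norm_num, show (1 : ℂ) - 1 / 2 = 1 / 2 by norm_num,
    clog_half, polyLog_three_neg_one] at h
  linear_combination h / 2

/-! ### The integral of `Li_2(t)/(1-t)` along segments -/

lemma one_sub_mem_slitPlane {z : ℂ} (hz : ‖z‖ ≤ 1) (h1 : z ≠ 1) : 1 - z ∈ Complex.slitPlane := by
  by_contra h
  rw [Complex.mem_slitPlane_iff, not_or, not_lt, not_not] at h
  simp only [Complex.sub_re, Complex.one_re, Complex.sub_im, Complex.one_im] at h
  have h2 := (Complex.re_le_norm z).trans hz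
  exact h1 (Complex.ext (by simp; linarith) (by simp; linarith))

lemma norm_ofReal_mul_le {s : ℝ} (hs : s ∈ Set.Icc (0 : ℝ) 1) {x : ℂ} (hx : ‖x‖ ≤ 1) :
    ‖(s : ℂ) * x‖ ≤ 1 := by
  rw [norm_mul, Complex.norm_real, Real.norm_of_nonneg hs.1]
  exact mul_le_one₀ hs.2 (norm_nonneg _) hx

lemma norm_ofReal_mul_lt {s : ℝ} (hs : s ∈ Set.Ico (0 : ℝ) 1) {x : ℂ} (hx : ‖x‖ ≤ 1) :
    ‖(s : ℂ) * x‖ < 1 := by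
  rw [norm_mul, Complex.norm_real, Real.norm_of_nonneg hs.1]
  exact (mul_le_of_le_one_right hs.1 hx).trans_lt hs.2

lemma ofReal_mul_ne_one {s : ℝ} (hs : s ∈ Set.Icc (0 : ℝ) 1) {x : ℂ} (hx : ‖x‖ ≤ 1)
    (h1 : x ≠ 1) : (s : ℂ) * x ≠ 1 := by
  rcases hs.2.eq_or_lt with rfl | h
  · simpa using h1
  · intro h2
    have := norm_ofReal_mul_lt ⟨hs.1, h⟩ hx
    rw [h2, norm_one] at this
    exact lt_irrefl _ this

lemma intervalIntegrable_dilogKernel {x : ℂ} (hx : ‖x‖ ≤ 1) (h1 : x ≠ 1) :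
    IntervalIntegrable (fun s : ℝ => x * dilogKernel ((s : ℂ) * x)) volume 0 1 := by
  refine ContinuousOn.intervalIntegrable ?_
  rw [Set.uIcc_of_le zero_le_one]
  refine continuousOn_const.mul (ContinuousOn.div
    (continuousOn_polyLog_comp le_rfl (by fun_prop) fun s hs => norm_ofReal_mul_le hs hx)
    (by fun_prop) fun s hs => sub_ne_zero.mpr (ofReal_mul_ne_one hs hx h1).symm)

/-- Differentiability is needed only inside the segment, so `x` may lie on the unit circle, where
the polylogarithms are merely known to be continuous. -/
lemma segmentIntegral_dilogKernel_eq {x : ℂ} (hx : ‖x‖ ≤ 1) (h1 : x ≠ 1) {g : ℝ → ℂ}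
    (hc : ContinuousOn g (Set.Icc 0 1))
    (hd : ∀ s ∈ Set.Ioo (0 : ℝ) 1, HasDerivAt g (x * dilogKernel ((s : ℂ) * x)) s) :
    segmentIntegral dilogKernel x = g 1 - g 0 :=
  intervalIntegral.integral_eq_sub_of_hasDerivAt_of_le zero_le_one hc hd
    (intervalIntegrable_dilogKernel hx h1)

/-- With `w = 1 - t` the integrand becomes `-Li_2(1-w)/w`; reflection turns it into the derivative
of `2 Li_3(w) - log w (π²/6 + Li_2(w))`. -/
lemma segmentIntegral_dilogKernel_one_sub {y : ℝ} (h0 : 0 < y) (h1 : y ≤ 1) :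
    segmentIntegral dilogKernel (1 - y)
      = 2 * polyLog 3 y - 2 * riemannZeta 3
        - Complex.log y * ((Real.pi : ℂ) ^ 2 / 6 + polyLog 2 y) := by
  have hy : ‖1 - (y : ℂ)‖ ≤ 1 := by
    rw [← Complex.ofReal_one, ← Complex.ofReal_sub]
    exact norm_ofReal_le_one (by linarith) (by linarith)
  have hp : ∀ s ∈ Set.Icc (0 : ℝ) 1, 0 < 1 - s * (1 - y) := fun s hs => by
    nlinarith [hs.1, hs.2, mul_nonneg hs.1 h0.le]
  have hq : ∀ s ∈ Set.Icc (0 : ℝ) 1, 1 - s * (1 - y) ≤ 1 := fun s hs => by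
    nlinarith [mul_nonneg hs.1 (sub_nonneg.mpr h1)]
  have key := segmentIntegral_dilogKernel_eq (x := 1 - y) hy
    (by intro h; apply h0.ne'; exact_mod_cast (sub_eq_self.mp h))
    (g := fun s => 2 * polyLog 3 (1 - s * (1 - y) : ℝ)
        - Complex.log (1 - s * (1 - y) : ℝ)
          * ((Real.pi : ℂ) ^ 2 / 6 + polyLog 2 (1 - s * (1 - y) : ℝ))) ?_ ?_
  · rw [key]
    simp [polyLog_three_one]
    ring
  · have hcf : ContinuousOn (fun s : ℝ => ((1 - s * (1 - y) : ℝ) : ℂ)) (Set.Icc 0 1) := by fun_prop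
    have hn : ∀ s ∈ Set.Icc (0 : ℝ) 1, ‖((1 - s * (1 - y) : ℝ) : ℂ)‖ ≤ 1 := fun s hs =>
      norm_ofReal_le_one (by linarith [hp s hs]) (hq s hs)
    exact (continuousOn_const.mul (continuousOn_polyLog_comp (by norm_num) hcf hn)).sub
      ((hcf.clog fun s hs => Complex.ofReal_mem_slitPlane.mpr (hp s hs)).mul
        (continuousOn_const.add (continuousOn_polyLog_comp le_rfl hcf hn)))
  · intro s hs
    -- For `y = 1` the segment is a point and `w` stays at `1`, outside the open disk.
    rcases h1.eq_or_lt with rfl | h1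
    · simpa using hasDerivAt_const s _
    have hs' := Set.Ioo_subset_Icc_self hs
    have hw0 := hp s hs'
    have hw1 : 1 - s * (1 - y) < 1 := by nlinarith [mul_pos hs.1 (sub_pos.mpr h1)]
    set w : ℝ := 1 - s * (1 - y) with hw
    have hwc : (w : ℂ) ≠ 0 := by exact_mod_cast hw0.ne'
    have hwn : ‖(w : ℂ)‖ < 1 := norm_ofReal_lt_one (by linarith) hw1
    have a := (((hasDerivAt_polyLog_three hwn hwc).const_mul 2).sub
      ((Complex.hasDerivAt_log (Complex.ofReal_mem_slitPlane.mpr hw0)).mul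
        ((hasDerivAt_polyLog_two hwn hwc).const_add ((Real.pi : ℂ) ^ 2 / 6)))).comp_ofReal
    have b : HasDerivAt (fun s : ℝ => 1 - s * (1 - y)) (-(1 - y)) s := by
      simpa using ((hasDerivAt_id s).mul_const (1 - y)).const_sub 1
    refine (a.scomp s b).congr_deriv ?_
    have r : polyLog 2 (1 - w) = (Real.pi : ℂ) ^ 2 / 6 - Complex.log w * Complex.log (1 - w)
        - polyLog 2 w :=
      eq_sub_of_add_eq' (polyLog_two_reflection hw0.le hw1.le)
    have e : (s : ℂ) * (1 - y) = 1 - w := by rw [hw]; push_cast; ring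
    rw [dilogKernel, e, r, Complex.real_smul, sub_sub_cancel]
    push_cast
    field_simp
    ring

/-- Here `1 - t` exceeds `1`, so its inverse `w = 1/(1+s)` is used, with `t = 1 - 1/w`. Landen's
identity then adds the term `-log³ w / 6` to the previous antiderivative. -/
lemma segmentIntegral_dilogKernel_neg_one :
    segmentIntegral dilogKernel (-1)
      = (Real.pi : ℂ) ^ 2 / 12 * Complex.log 2 - riemannZeta 3 / 4 := by
  have hp : ∀ s ∈ Set.Icc (0 : ℝ) 1, 1 / 2 ≤ (1 + s)⁻¹ ∧ (1 + s)⁻¹ ≤ 1 := fun s hs =>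
    ⟨by rw [le_inv_comm₀ (by norm_num) (by linarith [hs.1])]; linarith [hs.2],
      inv_le_one_of_one_le₀ (by linarith [hs.1])⟩
  have key := segmentIntegral_dilogKernel_eq (x := -1) (by simp) (by norm_num)
    (g := fun s => 2 * polyLog 3 ((1 + s)⁻¹ : ℝ)
        - Complex.log ((1 + s)⁻¹ : ℝ) * ((Real.pi : ℂ) ^ 2 / 6 + polyLog 2 ((1 + s)⁻¹ : ℝ))
        - Complex.log ((1 + s)⁻¹ : ℝ) ^ 3 / 6) ?_ ?_
  · rw [key]
    have e : (((1 + 1 : ℝ)⁻¹ : ℝ) : ℂ) = 1 / 2 := by push_cast; norm_num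
    rw [e]
    simp only [add_zero, inv_one, Complex.ofReal_one, Complex.log_one, polyLog_three_one,
      polyLog_three_half, polyLog_two_half, clog_half]
    ring
  · have hcf : ContinuousOn (fun s : ℝ => (((1 + s)⁻¹ : ℝ) : ℂ)) (Set.Icc 0 1) :=
      Complex.continuous_ofReal.comp_continuousOn
        (ContinuousOn.inv₀ (by fun_prop) fun s hs => by linarith [hs.1])
    have hn : ∀ s ∈ Set.Icc (0 : ℝ) 1, ‖(((1 + s)⁻¹ : ℝ) : ℂ)‖ ≤ 1 := fun s hs =>
      norm_ofReal_le_one (by linarith [(hp s hs).1]) (hp s hs).2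
    have hl := hcf.clog fun s hs =>
      Complex.ofReal_mem_slitPlane.mpr (by linarith [(hp s hs).1])
    exact ((continuousOn_const.mul (continuousOn_polyLog_comp (by norm_num) hcf hn)).sub
      (hl.mul (continuousOn_const.add (continuousOn_polyLog_comp le_rfl hcf hn)))).sub
      ((hl.pow 3).div_const 6)
  · intro s hs
    have hs' := Set.Ioo_subset_Icc_self hs
    have hs1 : 1 + s ≠ 0 := by linarith [hs.1]
    have hw0 : 0 < (1 + s)⁻¹ := by linarith [(hp s hs').1]
    have hw1 : (1 + s)⁻¹ < 1 := inv_lt_one_of_one_lt₀ (by linarith [hs.1])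
    have b : HasDerivAt (fun s : ℝ => (1 + s)⁻¹) (-((1 + s)⁻¹) ^ 2) s := by
      refine (((hasDerivAt_id s).const_add 1).inv hs1).congr_deriv ?_
      simp [neg_div]
    have hp' := hp s hs'
    have e0 : (((1 + s)⁻¹ : ℝ) : ℂ)⁻¹ = 1 + s := by push_cast; rw [inv_inv]
    set w : ℝ := (1 + s)⁻¹ with hw
    have hwc : (w : ℂ) ≠ 0 := by exact_mod_cast hw0.ne'
    have hwn : ‖(w : ℂ)‖ < 1 := norm_ofReal_lt_one (by linarith) hw1
    have l := Complex.hasDerivAt_log (Complex.ofReal_mem_slitPlane.mpr hw0)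
    have a := ((((hasDerivAt_polyLog_three hwn hwc).const_mul 2).sub
      (l.mul ((hasDerivAt_polyLog_two hwn hwc).const_add ((Real.pi : ℂ) ^ 2 / 6)))).sub
        ((l.pow 3).div_const 6)).comp_ofReal
    refine (a.scomp s b).congr_deriv ?_
    have r1 : polyLog 2 (1 - w) = (Real.pi : ℂ) ^ 2 / 6 - Complex.log w * Complex.log (1 - w)
        - polyLog 2 w :=
      eq_sub_of_add_eq' (polyLog_two_reflection hw0.le hw1.le)
    have r2 : polyLog 2 (1 - (w : ℂ)⁻¹) = -Complex.log w ^ 2 / 2 - polyLog 2 (1 - w) :=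
      eq_sub_of_add_eq' (polyLog_two_landen hp'.1 hp'.2)
    have e1 : (s : ℂ) * (-1) = 1 - (w : ℂ)⁻¹ := by rw [e0]; ring
    rw [dilogKernel, e1, r2, r1, Complex.real_smul]
    push_cast
    rw [sub_sub_cancel]
    field_simp
    ring

/-! ### The tails of the alternating series and uniform convergence -/

/-- The tail of the alternating harmonic series as an integral. -/
lemma skewHarmonic_sub_log_two (n : ℕ) :
    skewHarmonic n - Real.log 2 = (-1) ^ (n + 1) * ∫ t in (0 : ℝ)..1, t ^ n / (1 + t) := by
  have hi : ∀ k : ℕ, IntervalIntegrable (fun t : ℝ => t ^ k / (1 + t)) volume 0 1 := fun k => by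
    refine ContinuousOn.intervalIntegrable (ContinuousOn.div (by fun_prop) (by fun_prop) ?_)
    intro t ht
    rw [Set.uIcc_of_le zero_le_one] at ht
    linarith [ht.1]
  induction n with
  | zero =>
    have h := intervalIntegral.integral_comp_add_left (a := 0) (b := 1) (fun t : ℝ => t⁻¹) 1
    rw [integral_inv_of_pos (by norm_num) (by norm_num)] at h
    simp [skewHarmonic, h]
    norm_num
  | succ n ih =>
    have h : (∫ t in (0 : ℝ)..1, t ^ n / (1 + t)) + ∫ t in (0 : ℝ)..1, t ^ (n + 1) / (1 + t)
        = 1 / ((n : ℝ) + 1) := by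
      rw [← intervalIntegral.integral_add (hi n) (hi (n + 1))]
      rw [intervalIntegral.integral_congr (g := fun t => t ^ n), integral_pow]
      · simp
      · intro t ht
        rw [Set.uIcc_of_le zero_le_one] at ht
        have : 1 + t ≠ 0 := by linarith [ht.1]
        simp only
        field_simp
        ring
    rw [skewHarmonic, Finset.sum_range_succ, ← skewHarmonic, add_sub_right_comm, ih,
      eq_sub_of_add_eq' h]
    ring

lemma abs_skewHarmonic_sub_log_two_le (n : ℕ) :
    |skewHarmonic n - Real.log 2| ≤ 1 / ((n : ℝ) + 1) := by
  rw [skewHarmonic_sub_log_two, abs_mul, abs_pow, abs_neg, abs_one, one_pow, one_mul]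
  have h0 : ∀ t ∈ Set.Icc (0 : ℝ) 1, 0 ≤ t ^ n / (1 + t) := fun t ht =>
    div_nonneg (pow_nonneg ht.1 n) (by linarith [ht.1])
  rw [abs_of_nonneg (intervalIntegral.integral_nonneg zero_le_one h0)]
  have h1 : ∫ t in (0 : ℝ)..1, t ^ n = 1 / ((n : ℝ) + 1) := by simp [integral_pow]
  rw [← h1]
  refine intervalIntegral.integral_mono_on zero_le_one ?_ (by simp) fun t ht =>
    div_le_self (pow_nonneg ht.1 n) (by linarith [ht.1])
  refine ContinuousOn.intervalIntegrable (ContinuousOn.div (by fun_prop) (by fun_prop) ?_)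
  intro t ht
  rw [Set.uIcc_of_le zero_le_one] at ht
  linarith [ht.1]

/-- The complex number `skewHarmonic n - log 2`. -/
def skewTail (n : ℕ) : ℂ := (skewHarmonic n : ℂ) - Complex.log 2

lemma skewTail_zero : skewTail 0 = -Complex.log 2 := by simp [skewTail, skewHarmonic]

lemma skewTail_succ (n : ℕ) : skewTail (n + 1) = skewTail n + (-1) ^ n / ((n : ℂ) + 1) := by
  simp only [skewTail, skewHarmonic, Finset.sum_range_succ]
  push_cast
  ring

lemma norm_skewTail_le (n : ℕ) : ‖skewTail n‖ ≤ 1 / ((n : ℝ) + 1) := by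
  have h : skewTail n = ((skewHarmonic n - Real.log 2 : ℝ) : ℂ) := by
    rw [skewTail, ← Complex.ofReal_ofNat, ← Complex.ofReal_log (by norm_num)]
    push_cast
    rfl
  rw [h, Complex.norm_real]
  exact abs_skewHarmonic_sub_log_two_le n

lemma one_div_natCast_add_one_le_one (n : ℕ) : 1 / ((n : ℝ) + 1) ≤ 1 :=
  div_le_one_of_le₀ (by linarith [n.cast_nonneg (α := ℝ)]) (by positivity)

lemma norm_skewTail_le_one (n : ℕ) : ‖skewTail n‖ ≤ 1 :=
  (norm_skewTail_le n).trans (one_div_natCast_add_one_le_one n)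

lemma norm_skewTerm_le {x : ℂ} (hx : ‖x‖ ≤ 1) (n : ℕ) :
    ‖skewTerm x n‖ ≤ 1 / ((n : ℝ) + 1) ^ 2 := by
  have h1 : ‖(n : ℂ) + 1‖ = n + 1 := by
    rw [← Nat.cast_add_one, Complex.norm_natCast]; push_cast; rfl
  have h2 : ‖x ^ (n + 1) / ((n : ℂ) + 1)‖ ≤ 1 := by
    rw [norm_div, norm_pow, h1]
    exact div_le_one_of_le₀ ((pow_le_one₀ (norm_nonneg _) hx).trans
      (by linarith [n.cast_nonneg (α := ℝ)])) (by positivity)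
  have h3 : ‖skewTail n ^ 2‖ ≤ 1 / ((n : ℝ) + 1) ^ 2 := by
    rw [norm_pow, ← one_div_pow]
    exact pow_le_pow_left₀ (norm_nonneg _) (norm_skewTail_le n) 2
  calc ‖skewTerm x n‖ = ‖skewTail n ^ 2‖ * ‖x ^ (n + 1) / ((n : ℂ) + 1)‖ := norm_mul _ _
    _ ≤ 1 / ((n : ℝ) + 1) ^ 2 * 1 := mul_le_mul h3 h2 (norm_nonneg _) (by positivity)
    _ = _ := mul_one _

lemma summable_skewTerm {x : ℂ} (hx : ‖x‖ ≤ 1) : Summable (skewTerm x) :=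
  Summable.of_norm_bounded summable_one_div_natCast_add_one_sq (norm_skewTerm_le hx)

/-- By the Weierstrass M-test. This continuity carries every identity to the unit circle. -/
lemma continuousOn_tsum_skewTerm :
    ContinuousOn (fun x => ∑' n, skewTerm x n) (Metric.closedBall 0 1) :=
  continuousOn_tsum (fun n => by unfold skewTerm; fun_prop) summable_one_div_natCast_add_one_sq
    fun n x hx => norm_skewTerm_le (by simpa using hx) n

/-! ### Generating functions of the tails and of their squares -/

lemma clog_div_two {z : ℂ} (hz : z ≠ 0) : Complex.log (z / 2) = Complex.log z - Complex.log 2 := by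
  have h := Complex.log_ofReal_mul (r := 2⁻¹) (by norm_num) hz
  rw [Real.log_inv] at h
  push_cast at h
  rw [div_eq_inv_mul, h, Complex.ofReal_log (by norm_num)]
  push_cast
  ring

lemma norm_one_add_div_two_lt {x : ℂ} (hx : ‖x‖ < 1) : ‖(1 + x) / 2‖ < 1 := by
  have := norm_add_le 1 x
  rw [norm_one] at this
  rw [norm_div, Complex.norm_ofNat]
  linarith

lemma norm_one_add_div_two_le {x : ℂ} (hx : ‖x‖ ≤ 1) : ‖(1 + x) / 2‖ ≤ 1 := by
  have := norm_add_le 1 x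
  rw [norm_one] at this
  rw [norm_div, Complex.norm_ofNat]
  linarith

lemma one_sub_ne_zero {x : ℂ} (hx : ‖x‖ < 1) : 1 - x ≠ 0 := by
  intro h
  rw [← sub_eq_zero.mp h, norm_one] at hx
  exact lt_irrefl _ hx

lemma one_add_ne_zero {x : ℂ} (hx : ‖x‖ < 1) : 1 + x ≠ 0 := by
  simpa using one_sub_ne_zero (x := -x) (by simpa using hx)

lemma hasDerivAt_polyLog_two_half_add {x : ℂ} (hx : ‖x‖ < 1) :
    HasDerivAt (fun x => polyLog 2 ((1 + x) / 2))
      (-(Complex.log (1 - x) - Complex.log 2) / (1 + x)) x := by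
  have h0 := one_add_ne_zero hx
  have h := (hasDerivAt_polyLog_two (norm_one_add_div_two_lt hx) (by simpa using h0)).comp x
    (((hasDerivAt_id x).const_add 1).div_const 2)
  refine h.congr_deriv ?_
  rw [show 1 - (1 + x) / 2 = (1 - x) / 2 by ring, clog_div_two (one_sub_ne_zero hx)]
  field_simp

lemma hasDerivAt_polyLog_two_half_sub {x : ℂ} (hx : ‖x‖ < 1) :
    HasDerivAt (fun x => polyLog 2 ((1 - x) / 2))
      ((Complex.log (1 + x) - Complex.log 2) / (1 - x)) x := by
  have h := (hasDerivAt_polyLog_two_half_add (x := -x) (by simpa using hx)).comp x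
    (hasDerivAt_neg x)
  refine (h.congr_deriv ?_).congr_of_eventuallyEq (Eventually.of_forall fun z => ?_)
  · rw [sub_neg_eq_add, ← sub_eq_add_neg]
    ring
  · simp [sub_eq_add_neg]

lemma hasDerivAt_polyLog_three_half_sub {x : ℂ} (hx : ‖x‖ < 1) :
    HasDerivAt (fun x => polyLog 3 ((1 - x) / 2)) (-polyLog 2 ((1 - x) / 2) / (1 - x)) x := by
  have h0 := one_sub_ne_zero hx
  have h1 : ‖(1 - x) / 2‖ < 1 := by
    simpa [sub_eq_add_neg] using norm_one_add_div_two_lt (x := -x) (by simpa using hx)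
  have h := (hasDerivAt_polyLog_three h1 (by simpa using h0)).comp x
    (((hasDerivAt_id x).const_sub 1).div_const 2)
  refine h.congr_deriv ?_
  field_simp

lemma eq_apply_zero_of_hasDerivAt_zero {f : ℂ → ℂ} (hf : ∀ z : ℂ, ‖z‖ < 1 → HasDerivAt f 0 z) {x : ℂ}
    (hx : ‖x‖ < 1) : f x = f 0 := by
  have h : ∀ s ∈ Set.Icc (0 : ℝ) 1, HasDerivAt (fun s : ℝ => f (s * x)) 0 s := fun s hs => by
    have h1 : ‖(s : ℂ) * x‖ < 1 := by
      rw [norm_mul, Complex.norm_real, Real.norm_of_nonneg hs.1]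
      exact (mul_le_of_le_one_left (norm_nonneg _) hs.2).trans_lt hx
    have h2 := (hf _ h1).comp (s : ℂ) ((hasDerivAt_id (s : ℂ)).mul_const x)
    exact (h2.congr_deriv (by simp)).comp_ofReal
  have key := eq_of_hasDerivAt_zero zero_le_one
    (fun s hs => (h s hs).continuousAt.continuousWithinAt)
    (fun s hs => h s (Set.Ioo_subset_Icc_self hs))
  simpa using key.symm

/-- Summation by parts at `-z`: the signs cancel in the differences, leaving the coefficients of
`Li_1(z)/z` from the second on; `skewTail 1 = 1 - log 2` supplies the first. -/
lemma one_add_mul_tsum_skewTail_succ {z : ℂ} (hz : ‖z‖ < 1) :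
    (1 + z) * ∑' n, skewTail (n + 1) * (-1) ^ n * z ^ n
      = polyLogQuot 1 z - Complex.log 2 := by
  have h := one_sub_mul_tsum (c := fun n => skewTail (n + 1)) (C := 1)
    (fun n => norm_skewTail_le_one _) (x := -z) (by simpa using hz)
  have h1 : ∀ n, skewTail (n + 1) * (-1) ^ n * z ^ n = skewTail (n + 1) * (-z) ^ n := fun n => by
    rw [neg_pow z]; ring
  simp_rw [h1]
  rw [sub_neg_eq_add] at h
  rw [h]
  have h2 := (summable_mul_pow_of_bounded (norm_inv_natCast_add_one_pow_le 1) hz).tsum_eq_zero_add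
  rw [← polyLogQuot] at h2
  have h3 : ∀ n : ℕ, (skewTail (n + 1 + 1) - skewTail (n + 1)) * (-z) ^ (n + 1)
      = ((((n + 1 : ℕ) : ℂ) + 1) ^ 1)⁻¹ * z ^ (n + 1) := fun n => by
    have h4 : (-1 : ℂ) ^ (n + 1) * (-1) ^ (n + 1) = 1 := by
      rw [← mul_pow]; simp
    rw [skewTail_succ (n + 1), neg_pow z, pow_one]
    linear_combination (z ^ (n + 1) / (((n + 1 : ℕ) : ℂ) + 1)) * h4
  simp_rw [h3]
  rw [h2, skewTail_succ, skewTail_zero]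
  simp
  ring

/-- The derivative is the previous quotient by `1 + z`; `1/(z(1+z)) = 1/z - 1/(1+z)` splits it into
the derivatives of the two dilogarithms. -/
lemma tsum_skewTail_succ {x : ℂ} (hx : ‖x‖ < 1) :
    ∑' n, skewTail (n + 1) * (-1) ^ n * (x ^ (n + 1) / ((n : ℂ) + 1))
      = polyLog 2 x - polyLog 2 ((1 + x) / 2) + polyLog 2 (1 / 2) := by
  have key := eq_apply_zero_of_hasDerivAt_zero (f := fun x =>
    ∑' n, skewTail (n + 1) * (-1) ^ n * (x ^ (n + 1) / ((n : ℂ) + 1))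
      - polyLog 2 x + polyLog 2 ((1 + x) / 2)) (fun z hz => ?_) hx
  · simp [polyLog_zero_right] at key
    rw [one_div]
    linear_combination key
  · have hb : ∀ n, ‖skewTail (n + 1) * (-1) ^ n‖ ≤ 1 := fun n => by
      simpa using norm_skewTail_le_one (n + 1)
    refine (((hasDerivAt_tsum_pow hb hz).sub (hasDerivAt_polyLog 1 hz)).add
      (hasDerivAt_polyLog_two_half_add hz)).congr_deriv ?_
    have h0 := one_add_ne_zero hz
    have h1 := one_add_mul_tsum_skewTail_succ hz
    have h2 := mul_polyLogQuot 1 z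
    rw [polyLog_one_left hz] at h2
    rw [eq_div_of_mul_eq h0 ((mul_comm _ _).trans h1)]
    field_simp
    linear_combination -h2

/-- The difference of consecutive squares is `2 a (n+1) (-1)^n/(n+1) - 1/(n+1)^2` with `a =
skewTail`. The initial `log² 2` cancels against the one in `2 Li_2(1/2)`. -/
lemma one_sub_mul_tsum_skewTail_sq {x : ℂ} (hx : ‖x‖ < 1) :
    (1 - x) * ∑' n, skewTail n ^ 2 * x ^ n
      = polyLog 2 x + (Real.pi : ℂ) ^ 2 / 6 - 2 * polyLog 2 ((1 + x) / 2) := by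
  have hb : ∀ n, ‖skewTail n ^ 2‖ ≤ 1 := fun n => by
    rw [norm_pow]; exact pow_le_one₀ (norm_nonneg _) (norm_skewTail_le_one n)
  have hb1 : ∀ n, ‖skewTail (n + 1) * (-1) ^ n * ((n : ℂ) + 1)⁻¹‖ ≤ 1 := fun n => by
    have h := norm_inv_natCast_add_one_pow_le 1 n
    rw [pow_one] at h
    rw [norm_mul]
    refine mul_le_one₀ ?_ (norm_nonneg _) h
    simpa using norm_skewTail_le_one (n + 1)
  have hs : Summable fun n : ℕ => skewTail (n + 1) * (-1) ^ n * (x ^ (n + 1) / ((n : ℂ) + 1)) :=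
    ((summable_mul_pow_of_bounded hb1 hx).mul_left x).congr fun n => by ring
  have h1 : ∀ n : ℕ, (skewTail (n + 1) ^ 2 - skewTail n ^ 2) * x ^ (n + 1)
      = 2 * (skewTail (n + 1) * (-1) ^ n * (x ^ (n + 1) / ((n : ℂ) + 1)))
        - x ^ (n + 1) / ((n : ℂ) + 1) ^ 2 := fun n => by
    have h4 : (-1 : ℂ) ^ n * (-1) ^ n = 1 := by rw [← mul_pow]; simp
    rw [skewTail_succ]
    simp only [div_eq_mul_inv, ← inv_pow]
    linear_combination (x ^ (n + 1) * ((n : ℂ) + 1)⁻¹ ^ 2) * (-h4)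
  rw [one_sub_mul_tsum hb hx]
  simp_rw [h1]
  rw [(hs.mul_left 2).tsum_sub (summable_polyLog le_rfl hx.le), tsum_mul_left,
    tsum_skewTail_succ hx, ← polyLog, skewTail_zero, polyLog_two_half]
  ring

/-! ### The closed form on the disk -/

/-- The part of `skewClosedForm` outside of the integral. -/
def skewElementary (x : ℂ) : ℂ :=
  Complex.log (1 - x) * (2 * polyLog 2 ((1 + x) / 2) - (Real.pi : ℂ) ^ 2 / 6)
    + 2 * Complex.log (1 + x) * (Complex.log (1 - x) ^ 2 - Complex.log 2 ^ 2)
    + 2 * Complex.log 2 * (polyLog 2 ((1 + x) / 2) - polyLog 2 (1 / 2))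
    - 2 * Complex.log 2 * Complex.log (1 - x) ^ 2
    + 4 * Complex.log (1 - x) * polyLog 2 ((1 - x) / 2)
    - 4 * (polyLog 3 ((1 - x) / 2) - polyLog 3 (1 / 2))

lemma skewClosedForm_eq (x : ℂ) :
    skewClosedForm x = segmentIntegral dilogKernel x + skewElementary x := by
  unfold skewClosedForm skewElementary
  ring

/-- All contributions over `1 + x` cancel; over `1 - x` only those from differentiating the very
first `log (1 - x)` survive. -/
lemma hasDerivAt_skewElementary {x : ℂ} (hx : ‖x‖ < 1) :
    HasDerivAt skewElementary
      (((Real.pi : ℂ) ^ 2 / 6 - 2 * polyLog 2 ((1 + x) / 2)) / (1 - x)) x := by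
  have h0 := one_add_ne_zero hx
  have h1 := one_sub_ne_zero hx
  have l1 := hasDerivAt_clog_one_sub
    (one_sub_mem_slitPlane hx.le (by rintro rfl; simp at hx))
  have l2 : HasDerivAt (fun z => Complex.log (1 + z)) (1 / (1 + x)) x :=
    ((hasDerivAt_id x).const_add 1).clog (by
      simpa using one_sub_mem_slitPlane (z := -x) (by simpa using hx.le)
        (by rintro h; rw [← norm_neg, h] at hx; simp at hx))
  have p := hasDerivAt_polyLog_two_half_add hx
  have q := hasDerivAt_polyLog_two_half_sub hx
  have t := hasDerivAt_polyLog_three_half_sub hx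
  have key := (((((l1.mul ((p.const_mul 2).sub_const ((Real.pi : ℂ) ^ 2 / 6))).add
    ((l2.const_mul 2).mul ((l1.pow 2).sub_const (Complex.log 2 ^ 2)))).add
    ((p.sub_const (polyLog 2 (1 / 2))).const_mul (2 * Complex.log 2))).sub
    ((l1.pow 2).const_mul (2 * Complex.log 2))).add
    ((l1.const_mul 4).mul q)).sub ((t.sub_const (polyLog 3 (1 / 2))).const_mul 4)
  refine key.congr_deriv ?_
  simp only [Pi.pow_apply]
  field_simp
  ring

lemma continuousOn_skewElementary_ray {x : ℂ} (hx : ‖x‖ ≤ 1) (h1 : x ≠ 1) :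
    ContinuousOn (fun s : ℝ => skewElementary (s * x)) (Set.Icc 0 1) := by
  have hf : ContinuousOn (fun s : ℝ => (s : ℂ) * x) (Set.Icc 0 1) := by fun_prop
  have hl : ContinuousOn (fun s : ℝ => Complex.log (1 - s * x)) (Set.Icc 0 1) :=
    (continuousOn_const.sub hf).clog fun s hs =>
      one_sub_mem_slitPlane (norm_ofReal_mul_le hs hx) (ofReal_mul_ne_one hs hx h1)
  have hp : ContinuousOn (fun s : ℝ => polyLog 2 ((1 + s * x) / 2)) (Set.Icc 0 1) :=
    continuousOn_polyLog_comp le_rfl (by fun_prop) fun s hs =>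
      norm_one_add_div_two_le (norm_ofReal_mul_le hs hx)
  have hn : ∀ s ∈ Set.Icc (0 : ℝ) 1, ‖(1 - s * x) / 2‖ ≤ 1 := fun s hs => by
    simpa [sub_eq_add_neg] using norm_one_add_div_two_le (x := -(s * x))
      (by simpa using norm_ofReal_mul_le hs hx)
  have hq : ContinuousOn (fun s : ℝ => polyLog 2 ((1 - s * x) / 2)) (Set.Icc 0 1) :=
    continuousOn_polyLog_comp le_rfl (by fun_prop) hn
  have ht : ContinuousOn (fun s : ℝ => polyLog 3 ((1 - s * x) / 2)) (Set.Icc 0 1) :=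
    continuousOn_polyLog_comp (by norm_num) (by fun_prop) hn
  have hm : ContinuousOn (fun s : ℝ => 2 * Complex.log (1 + s * x)
      * (Complex.log (1 - s * x) ^ 2 - Complex.log 2 ^ 2)) (Set.Icc 0 1) := by
    intro s hs
    -- The only singular point is `s = 1`, `x = -1`. With `y = 1 - s` the product is `log y` times a
    -- differentiable function vanishing at `y = 0`.
    by_cases h2 : (s : ℂ) * x = -1
    · have h3 : ‖(s : ℂ) * x‖ = 1 := by rw [h2]; simp
      have hs1 : s = 1 := by
        by_contra h
        exact (norm_ofReal_mul_lt ⟨hs.1, lt_of_le_of_ne hs.2 h⟩ hx).ne h3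
      subst hs1
      have hx1 : x = -1 := by simpa using h2
      subst hx1
      have hd : DifferentiableAt ℝ
          (fun y : ℝ => 2 * (Complex.log (2 - (y : ℂ)) ^ 2 - Complex.log 2 ^ 2)) 0 := by
        have h4 : HasDerivAt (fun z : ℂ => Complex.log (2 - z)) (-1 / (2 - ((0 : ℝ) : ℂ)))
            ((0 : ℝ) : ℂ) := ((hasDerivAt_id _).const_sub 2).clog (by simp)
        exact (((h4.pow 2).sub_const _).const_mul 2).comp_ofReal.differentiableAt
      have h5 := continuousWithinAt_log_mul hd (by simp)
      have h6 : ContinuousWithinAt (fun x : ℝ => 1 - x) (Set.Icc 0 1) 1 := by fun_prop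
      have h7 := ContinuousWithinAt.comp (t := Set.Ici (0 : ℝ)) (x := (1 : ℝ))
        (by rw [sub_self]; exact h5) h6 (fun x hx => sub_nonneg.mpr hx.2)
      have h8 : ∀ y : ℝ, 2 * Complex.log (1 + y * (-1))
          * (Complex.log (1 - y * (-1)) ^ 2 - Complex.log 2 ^ 2)
          = ((fun y : ℝ => Complex.log (y : ℂ)
            * (2 * (Complex.log (2 - (y : ℂ)) ^ 2 - Complex.log 2 ^ 2))) ∘ fun x => 1 - x) y := by
        intro y
        simp only [Function.comp]
        push_cast
        rw [show (2 : ℂ) - (1 - y) = 1 - y * (-1) by ring, show (1 : ℂ) + y * (-1) = 1 - y by ring]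
        ring
      exact h7.congr (fun y _ => h8 y) (h8 1)
    · refine ContinuousWithinAt.mul (continuousWithinAt_const.mul
        (ContinuousWithinAt.clog (continuousWithinAt_const.add (hf s hs)) ?_))
        (((hl s hs).pow 2).sub continuousWithinAt_const)
      simpa using one_sub_mem_slitPlane (z := -(s * x))
        (by simpa using norm_ofReal_mul_le hs hx) (by rwa [ne_eq, neg_eq_iff_eq_neg])
  exact (((((hl.mul ((continuousOn_const.mul hp).sub continuousOn_const)).add hm).add
    (continuousOn_const.mul (hp.sub continuousOn_const))).sub
    (continuousOn_const.mul (hl.pow 2))).add ((continuousOn_const.mul hl).mul hq)).sub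
    (continuousOn_const.mul (ht.sub continuousOn_const))

lemma hasDerivAt_tsum_skewTerm {x : ℂ} (hx : ‖x‖ < 1) :
    HasDerivAt (fun x => ∑' n, skewTerm x n) (∑' n, skewTail n ^ 2 * x ^ n) x :=
  hasDerivAt_tsum_pow (c := fun n => skewTail n ^ 2) (C := 1) (fun n => by
    rw [norm_pow]; exact pow_le_one₀ (norm_nonneg _) (norm_skewTail_le_one n)) hx

/-- Along the ray to `x`, the series minus `skewElementary` is an antiderivative of the integrand,
continuous up to the end. -/
lemma tsum_skewTerm {x : ℂ} (hx : ‖x‖ ≤ 1) (h1 : x ≠ 1) :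
    ∑' n, skewTerm x n = skewClosedForm x := by
  have key := segmentIntegral_dilogKernel_eq hx h1
    (g := fun s : ℝ => ∑' n, skewTerm (s * x) n - skewElementary (s * x)) ?_ ?_
  · have h0 : skewElementary 0 = 0 := by simp [skewElementary]
    rw [skewClosedForm_eq, key]
    simp [h0, skewTerm]
  · refine ContinuousOn.sub ?_ (continuousOn_skewElementary_ray hx h1)
    exact continuousOn_tsum_skewTerm.comp (f := fun s : ℝ => (s : ℂ) * x) (by fun_prop)
      fun s hs => by simpa using norm_ofReal_mul_le hs hx
  · intro s hs
    have hz := norm_ofReal_mul_lt (Set.Ioo_subset_Ico_self hs) hx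
    have h := (((hasDerivAt_tsum_skewTerm hz).sub (hasDerivAt_skewElementary hz)).comp (s : ℂ)
      ((hasDerivAt_id (s : ℂ)).mul_const x)).comp_ofReal
    refine h.congr_deriv ?_
    have h2 := one_sub_ne_zero hz
    rw [eq_div_of_mul_eq h2 ((mul_comm _ _).trans (one_sub_mul_tsum_skewTail_sq hz)), dilogKernel]
    field_simp
    ring

/-! ### Values and limits at `x = 1` and `x = -1` -/

/-- `skewClosedForm (1 - y)` after cancellation of the logarithmic singularities at `y = 0`. -/
def skewBoundaryForm (y : ℝ) : ℂ :=
  2 * polyLog 3 y - 2 * riemannZeta 3 - Complex.log y * polyLog 2 y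
    + 2 * Complex.log 2 * (Complex.log y * (Complex.log (2 - y) - Complex.log 2))
    - 2 * Complex.log (2 - y) * Complex.log 2 ^ 2
    + 2 * (Complex.log y * polyLog 2 (y / 2))
    + 2 * Complex.log 2 * (polyLog 2 (1 - y / 2) - polyLog 2 (1 / 2))
    - 4 * polyLog 3 (y / 2) + 4 * polyLog 3 (1 / 2)

/-- Reflection at `y/2` rewrites the dilogarithm multiplying `log y`. The terms in `log² y` and in
`π² log y` then cancel, and each remaining `log y` has a factor vanishing at `y = 0`. -/
lemma skewClosedForm_one_sub {y : ℝ} (h0 : 0 < y) (h1 : y ≤ 1) :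
    skewClosedForm (1 - y) = skewBoundaryForm y := by
  have h := polyLog_two_reflection (t := y / 2) (by linarith) (by linarith)
  have e1 : (1 : ℂ) - ((y / 2 : ℝ) : ℂ) = (2 - y) / 2 := by push_cast; ring
  have h2 : (2 : ℂ) - y ≠ 0 := by
    rw [sub_ne_zero]; intro h; have : (2 : ℝ) = y := by exact_mod_cast h
    linarith
  rw [e1, clog_div_two h2] at h
  push_cast at h
  rw [clog_div_two (by exact_mod_cast h0.ne')] at h
  unfold skewClosedForm skewBoundaryForm
  rw [segmentIntegral_dilogKernel_one_sub h0 h1, sub_sub_cancel,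
    show (1 : ℂ) + (1 - y) = 2 - y by ring, show (1 : ℂ) - y / 2 = (2 - y) / 2 by ring,
    eq_sub_of_add_eq' h]
  ring

lemma continuousWithinAt_skewBoundaryForm :
    ContinuousWithinAt skewBoundaryForm (Set.Icc 0 1) 0 := by
  have hm : (0 : ℝ) ∈ Set.Icc (0 : ℝ) 1 := by simp
  have hn : ∀ y ∈ Set.Icc (0 : ℝ) 1, ‖(y : ℂ)‖ ≤ 1 := fun y hy =>
    norm_ofReal_le_one (by linarith [hy.1]) hy.2
  have hn2 : ∀ y ∈ Set.Icc (0 : ℝ) 1, ‖(y : ℂ) / 2‖ ≤ 1 := fun y hy => by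
    rw [norm_div, Complex.norm_ofNat]; linarith [hn y hy]
  have hn3 : ∀ y ∈ Set.Icc (0 : ℝ) 1, ‖1 - (y : ℂ) / 2‖ ≤ 1 := fun y hy => by
    rw [show (1 : ℂ) - y / 2 = ((1 - y / 2 : ℝ) : ℂ) by push_cast; rfl]
    exact norm_ofReal_le_one (by linarith [hy.2]) (by linarith [hy.1])
  have d : HasDerivAt (polyLog 2) (polyLogQuot 1 0) 0 := hasDerivAt_polyLog 1 (by simp)
  have m : HasDerivAt (fun z : ℂ => Complex.log (2 - z)) (-1 / (2 - ((0 : ℝ) : ℂ)))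
      ((0 : ℝ) : ℂ) := ((hasDerivAt_id _).const_sub 2).clog (by simp)
  have c1 := (continuousOn_polyLog_comp (m := 3) (by norm_num) (by fun_prop) hn) 0 hm
  have c2 := (continuousWithinAt_log_mul (h := fun y => polyLog 2 (y : ℂ))
    (HasDerivAt.comp_ofReal (z := 0) (by simpa using d)).differentiableAt
    (by simp [polyLog_zero_right])).mono (fun y (hy : y ∈ Set.Icc (0 : ℝ) 1) => hy.1)
  have c3 := (continuousWithinAt_log_mul (h := fun y => Complex.log (2 - (y : ℂ)) - Complex.log 2)
    (m.sub_const _).comp_ofReal.differentiableAt (by simp)).mono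
    (fun y (hy : y ∈ Set.Icc (0 : ℝ) 1) => hy.1)
  have c4 : ContinuousWithinAt (fun y : ℝ => Complex.log (2 - (y : ℂ))) (Set.Icc 0 1) 0 :=
    m.comp_ofReal.continuousAt.continuousWithinAt
  have d2 : HasDerivAt (fun z : ℂ => polyLog 2 (z / 2)) (polyLogQuot 1 0 * (1 / 2))
      ((0 : ℝ) : ℂ) :=
    HasDerivAt.comp (h₂ := polyLog 2) (h := fun z : ℂ => z / 2) ((0 : ℝ) : ℂ) (by simpa using d)
      ((hasDerivAt_id _).div_const 2)
  have c5 := (continuousWithinAt_log_mul (h := fun y => polyLog 2 ((y : ℂ) / 2))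
    d2.comp_ofReal.differentiableAt (by simp [polyLog_zero_right])).mono
    (fun y (hy : y ∈ Set.Icc (0 : ℝ) 1) => hy.1)
  have c6 := (continuousOn_polyLog_comp (m := 2) le_rfl (by fun_prop) hn3) 0 hm
  have c7 := (continuousOn_polyLog_comp (m := 3) (by norm_num) (by fun_prop) hn2) 0 hm
  exact ((((((((c1.const_mul 2).sub_const _).sub c2).add (c3.const_mul _)).sub
    ((c4.const_mul 2).mul_const _)).add (c5.const_mul 2)).add
    ((c6.sub_const _).const_mul _)).sub (c7.const_mul 4)).add_const _

/-- As the series is continuous on the closed disk, it suffices to approach `1` along the real axis.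
-/
lemma tsum_skewTerm_one :
    ∑' n, skewTerm 1 n = 3 / 2 * riemannZeta 3 - (Real.pi : ℂ) ^ 2 / 6 * Complex.log 2
        - 1 / 3 * Complex.log 2 ^ 3 := by
  have h0 : skewBoundaryForm 0 = 3 / 2 * riemannZeta 3
      - (Real.pi : ℂ) ^ 2 / 6 * Complex.log 2 - 1 / 3 * Complex.log 2 ^ 3 := by
    -- Every `log 0` is multiplied by zero, so its default value does not matter.
    simp only [skewBoundaryForm, Complex.ofReal_zero, zero_div, sub_zero, polyLog_zero_right,
      polyLog_two_one, polyLog_three_half, polyLog_two_half]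
    ring
  have h1 : ContinuousWithinAt (fun y : ℝ => ∑' n, skewTerm (1 - y) n) (Set.Icc 0 1) 0 := by
    refine (continuousOn_tsum_skewTerm.comp (f := fun y : ℝ => 1 - (y : ℂ)) (by fun_prop) ?_) 0
      (by simp)
    intro y hy
    rw [mem_closedBall_zero_iff]
    beta_reduce
    rw [← Complex.ofReal_one, ← Complex.ofReal_sub]
    exact norm_ofReal_le_one (by linarith [hy.2]) (by linarith [hy.1])
  have h2 := h1.tendsto.mono_left (nhdsWithin_mono 0 Set.Ioo_subset_Icc_self)
  have h3 := continuousWithinAt_skewBoundaryForm.tendsto.mono_left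
    (nhdsWithin_mono 0 Set.Ioo_subset_Icc_self)
  have : (𝓝[Set.Ioo (0 : ℝ) 1] 0).NeBot := left_nhdsWithin_Ioo_neBot one_pos
  have h4 := tendsto_nhds_unique_of_eventuallyEq h2 h3 ?_
  · rw [← h0, ← h4]
    simp
  · filter_upwards [self_mem_nhdsWithin] with y hy
    rw [← skewClosedForm_one_sub hy.1 hy.2.le, tsum_skewTerm]
    · rw [← Complex.ofReal_one, ← Complex.ofReal_sub]
      exact norm_ofReal_le_one (by linarith [hy.2]) (by linarith [hy.1])
    · intro h
      exact hy.1.ne' (by exact_mod_cast sub_eq_self.mp h)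

lemma skewClosedForm_neg_one :
    skewClosedForm (-1) = (Real.pi : ℂ) ^ 2 / 12 * Complex.log 2 - 3 / 4 * riemannZeta 3
        - 1 / 3 * Complex.log 2 ^ 3 := by
  -- The factor `log² 2 - log² 2` removes `log (1 + x)`, in agreement with the limit `0`.
  rw [skewClosedForm, segmentIntegral_dilogKernel_neg_one, show (1 : ℂ) - -1 = 2 by norm_num,
    show (1 : ℂ) + -1 = 0 by norm_num, zero_div, div_self two_ne_zero, polyLog_zero_right,
    polyLog_two_one, polyLog_three_one, polyLog_two_half, polyLog_three_half]
  ring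

/-- Away from `1` the closed form equals the series, so its limit in the disk, from any direction,
follows without examining the closed form itself. -/
lemma tendsto_skewClosedForm {a : ℂ} (ha : ‖a‖ ≤ 1) {s : Set ℂ}
    (hs : s ⊆ Metric.closedBall 0 1) (h1 : ∀ᶠ x in 𝓝[s] a, x ≠ 1) :
    Tendsto skewClosedForm (𝓝[s] a) (𝓝 (∑' n, skewTerm a n)) := by
  refine ((continuousOn_tsum_skewTerm a (by simpa using ha)).tendsto.mono_left
    (nhdsWithin_mono a hs)).congr' ?_
  filter_upwards [self_mem_nhdsWithin, h1] with x hx hx1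
  exact tsum_skewTerm (by simpa using hs hx) hx1

end

theorem proposition8 :
    -- the closed form on the closed unit disk; at `x = -1` the factor of `log (1 + x)` vanishes
    (∀ x : ℂ, ‖x‖ ≤ 1 → x ≠ 1 →
      IntervalIntegrable (fun s : ℝ => x * dilogKernel ((s : ℂ) * x)) volume 0 1 ∧
      HasSum (skewTerm x) (skewClosedForm x)) ∧
    -- the values at `x = 1` and `x = -1`
    HasSum (skewTerm 1)
      (3 / 2 * riemannZeta 3 - (Real.pi : ℂ) ^ 2 / 6 * Complex.log 2
        - 1 / 3 * Complex.log 2 ^ 3) ∧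
    HasSum (skewTerm (-1))
      ((Real.pi : ℂ) ^ 2 / 12 * Complex.log 2 - 3 / 4 * riemannZeta 3
        - 1 / 3 * Complex.log 2 ^ 3) ∧
    -- the closed form tends to these values, which is how it is read at `x = 1` and `x = -1`
    Tendsto skewClosedForm (𝓝[Metric.closedBall (0 : ℂ) 1 \ {1}] 1)
      (𝓝 (3 / 2 * riemannZeta 3 - (Real.pi : ℂ) ^ 2 / 6 * Complex.log 2
        - 1 / 3 * Complex.log 2 ^ 3)) ∧
    Tendsto skewClosedForm (𝓝[Metric.closedBall (0 : ℂ) 1 \ {-1}] (-1))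
      (𝓝 ((Real.pi : ℂ) ^ 2 / 12 * Complex.log 2 - 3 / 4 * riemannZeta 3
        - 1 / 3 * Complex.log 2 ^ 3)) := by
  have hneg : ∑' n, skewTerm (-1) n = (Real.pi : ℂ) ^ 2 / 12 * Complex.log 2
      - 3 / 4 * riemannZeta 3 - 1 / 3 * Complex.log 2 ^ 3 :=
    (tsum_skewTerm (by simp) (by norm_num)).trans skewClosedForm_neg_one
  refine ⟨fun x hx h1 => ⟨intervalIntegrable_dilogKernel hx h1, ?_⟩, ?_, ?_, ?_, ?_⟩
  · rw [← tsum_skewTerm hx h1]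
    exact (summable_skewTerm hx).hasSum
  · rw [← tsum_skewTerm_one]
    exact (summable_skewTerm (by simp)).hasSum
  · rw [← hneg]
    exact (summable_skewTerm (by simp)).hasSum
  · rw [← tsum_skewTerm_one]
    refine tendsto_skewClosedForm (by simp) Set.sdiff_subset ?_
    filter_upwards [self_mem_nhdsWithin] with x hx using hx.2
  · rw [← hneg]
    refine tendsto_skewClosedForm (by simp) Set.sdiff_subset ?_
    exact eventually_nhdsWithin_of_eventually_nhds (eventually_ne_nhds (by norm_num))
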